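/- Let $G$ be any group. Write $x^y=y^{-1}xy$ and $[x,y]=x^{-1}y^{-1}xy$. The non-abelian tensor square $G\otimes G$ is the group generated by symbols $g\otimes h$ ($g,h\in G$) subject to $gg_1\otimes h=(g^{g_1}\otimes h^{g_1})(g_1\otimes h)$ and $g\otimes hh_1=(g\otimes h_1)(g^{h_1}\otimes h^{h_1})$ for all $g,g_1,h,h_1\in G$. Let $G^{\varphi}=\{g^{\varphi}\mid g\in G\}$ be an isomorphic copy of $G$, and let $\nu(G)$ be the quotient of the free product $G*G^{\varphi}$ by the relations $$[g_1,g_2^{\varphi}]^{g_3}=[g_1^{g_3},(g_2^{g_3})^{\varphi}]=[g_1,g_2^{\varphi}]^{g_3^{\varphi}}\qquad(g_1,g_2,g_3\in G).$$ Let $\rho\colon\nu(G)\to G$ be the epimorphism with $\rho(g)=\rho(g^{\varphi})=g$ for $g\in G$. Put $\Theta(G)=\ker\rho$, $\Upsilon_1(G)=[G,G^{\varphi}]$, $\Upsilon_2(G)=[\Theta(G),G]$, $\Upsilon_3(G)=[\Theta(G),G^{\varphi}]$, where $G$ and $G^{\varphi}$ stand for their images in $\nu(G)$. Let $\mu(G)$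 be the kernel of the map $\Upsilon_1(G)\to G'$ obtained by restricting $\rho$. A prime denotes the derived subgroup. A group $H$ is a central product of normal subgroups $K_1,\dots,K_l$ if $H=K_1\cdots K_l$, $[K_i,K_j]=1$ for $i\neq j$, and $K_i\cap\prod_{j\neq i}K_j\le Z(H)$ for all $i$. Then: (a) $\Upsilon_2(G)$ and $\Upsilon_3(G)$ are both isomorphic to $G\otimes G$; (b) $\nu(G)'$ is a central product of its normal subgroups $\Upsilon_1(G)$, $\Upsilon_2(G)$ and $\Upsilon_3(G)$. Moreover, $\mu(G)$ is a normal subgroup of $\nu(G)'$ and $\nu(G)'/\mu(G)\cong G'\times G'\times G'$. -/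

import Mathlib

namespace NuGroup

/-- The conjugate `x ^ y = y⁻¹ x y`. -/
def cj {H : Type*} [Group H] (x y : H) : H := y⁻¹ * x * y

/-- The commutator `[x, y] = x⁻¹ y⁻¹ x y`. -/
def cm {H : Type*} [Group H] (x y : H) : H := x⁻¹ * cj x y

/-- The relators of the non-abelian tensor square; the free generator on `(g, h)` is `g ⊗ h`. -/
inductive IsTensorRelator (G : Type*) [Group G] : FreeGroup (G × G) → Prop
  /-- `g g₁ ⊗ h = (g ^ g₁ ⊗ h ^ g₁) (g₁ ⊗ h)` -/
  | left (g g₁ h : G) : IsTensorRelator G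
      (FreeGroup.of (g * g₁, h) *
        (FreeGroup.of (cj g g₁, cj h g₁) * FreeGroup.of (g₁, h))⁻¹)
  /-- `g ⊗ h h₁ = (g ⊗ h₁) (g ^ h₁ ⊗ h ^ h₁)` -/
  | right (g h h₁ : G) : IsTensorRelator G
      (FreeGroup.of (g, h * h₁) *
        (FreeGroup.of (g, h₁) * FreeGroup.of (cj g h₁, cj h h₁))⁻¹)

/-- The non-abelian tensor square `G ⊗ G`. -/
abbrev TensorSquare (G : Type*) [Group G] : Type _ :=
  PresentedGroup {r : FreeGroup (G × G) | IsTensorRelator G r}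

/-- The relators of `ν(G)` in the free product `G * G^φ`, where the second free factor `inr G`
is the isomorphic copy `G^φ` and `inr g` is `g^φ`. -/
inductive IsNuRelator (G : Type*) [Group G] : Monoid.Coprod G G → Prop
  /-- `[g₁, g₂^φ] ^ g₃ = [g₁ ^ g₃, (g₂ ^ g₃)^φ]` -/
  | left (g₁ g₂ g₃ : G) : IsNuRelator G
      (cj (cm (Monoid.Coprod.inl g₁) (Monoid.Coprod.inr g₂)) (Monoid.Coprod.inl g₃) *
        (cm (Monoid.Coprod.inl (cj g₁ g₃)) (Monoid.Coprod.inr (cj g₂ g₃)))⁻¹)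
  /-- `[g₁ ^ g₃, (g₂ ^ g₃)^φ] = [g₁, g₂^φ] ^ (g₃^φ)` -/
  | right (g₁ g₂ g₃ : G) : IsNuRelator G
      (cm (Monoid.Coprod.inl (cj g₁ g₃)) (Monoid.Coprod.inr (cj g₂ g₃)) *
        (cj (cm (Monoid.Coprod.inl g₁) (Monoid.Coprod.inr g₂)) (Monoid.Coprod.inr g₃))⁻¹)

/-- The group `ν(G)`. -/
abbrev Nu (G : Type*) [Group G] : Type _ :=
  Monoid.Coprod G G ⧸ Subgroup.normalClosure {r : Monoid.Coprod G G | IsNuRelator G r}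

variable (G : Type*) [Group G]

/-- The canonical map `G → ν(G)`, `g ↦ g`. -/
def ofG : G →* Nu G := (QuotientGroup.mk' _).comp Monoid.Coprod.inl

/-- The canonical map `G → ν(G)`, `g ↦ g^φ`. -/
def ofPhi : G →* Nu G := (QuotientGroup.mk' _).comp Monoid.Coprod.inr

theorem fold_relator {r : Monoid.Coprod G G} (h : IsNuRelator G r) :
    Monoid.Coprod.lift (MonoidHom.id G) (MonoidHom.id G) r = 1 := by
  cases h <;> simp [cj, cm] <;> group

theorem normalClosure_le_ker :
    Subgroup.normalClosure {r : Monoid.Coprod G G | IsNuRelator G r} ≤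
      (Monoid.Coprod.lift (MonoidHom.id G) (MonoidHom.id G)).ker :=
  Subgroup.normalClosure_le_normal fun _ h => fold_relator G h

/-- The epimorphism `ρ : ν(G) → G` with `ρ(g) = g = ρ(g^φ)`. -/
def rho : Nu G →* G :=
  QuotientGroup.lift _ (Monoid.Coprod.lift (MonoidHom.id G) (MonoidHom.id G))
    (normalClosure_le_ker G)

theorem rho_ofG (g : G) : rho G (ofG G g) = g := by
  simp [rho, ofG]

theorem rho_ofPhi (g : G) : rho G (ofPhi G g) = g := by
  simp [rho, ofPhi]

/-- `Θ(G) = ker ρ`. -/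
def Theta : Subgroup (Nu G) := (rho G).ker

/-- `Υ₁(G) = [G, G^φ]`. -/
def Upsilon₁ : Subgroup (Nu G) := ⁅(ofG G).range, (ofPhi G).range⁆

/-- `Υ₂(G) = [Θ(G), G]`. -/
def Upsilon₂ : Subgroup (Nu G) := ⁅Theta G, (ofG G).range⁆

/-- `Υ₃(G) = [Θ(G), G^φ]`. -/
def Upsilon₃ : Subgroup (Nu G) := ⁅Theta G, (ofPhi G).range⁆

theorem rho_mem (x : Upsilon₁ G) : rho G x ∈ commutator G := by
  have h : (Upsilon₁ G).map (rho G) ≤ commutator G := by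
    rw [Upsilon₁, Subgroup.map_commutator]
    exact Subgroup.commutator_mono le_top le_top
  exact h (Subgroup.mem_map_of_mem _ x.2)

/-- The derived map `ρ' : Υ₁(G) → G'`, the restriction of `ρ`. -/
def rho' : Upsilon₁ G →* commutator G :=
  ((rho G).comp (Upsilon₁ G).subtype).codRestrict (commutator G) (rho_mem G)

/-- `μ(G) = ker ρ'`, as a subgroup of `ν(G)`. -/
def mu : Subgroup (Nu G) := (rho' G).ker.map (Upsilon₁ G).subtype

/-- `H` is a central product of its normal subgroups `K i`. The product of a family of normal
subgroups is their join. -/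
structure IsCentralProduct {H : Type*} [Group H] {ι : Type*} (K : ι → Subgroup H) : Prop where
  normal : ∀ i, (K i).Normal
  prod_eq : ⨆ i, K i = ⊤
  commutator_eq : ∀ i j, i ≠ j → ⁅K i, K j⁆ = ⊥
  inf_le_center : ∀ i, K i ⊓ (⨆ (j) (_ : j ≠ i), K j) ≤ Subgroup.center H

end NuGroup

/-!
The generator `g ⊗ h` maps to `[g, h^φ]`, which gives a surjection of `G ⊗ G` onto `Υ₁(G)`. It is
injective because `ν(G)` maps to a group containing `G ⊗ G`: by the Peiffer identity (`conj_tmul`,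
obtained by expanding `g g₁ ⊗ h h₁` in two ways), `b^φ` acts on `(G ⊗ G) ⋊ G` by
`g ↦ g (g ⊗ b)`, and in `((G ⊗ G) ⋊ G) ⋊ G` the defining relations of `ν(G)` hold, with
`[g, h^φ] = g ⊗ h`.

The defining relations say that conjugation by `x` on `Υ₁(G)` depends only on `ρ(x)`, so `Θ(G)`
centralises `Υ₁(G)`. Hence `u ↦ ρ(u) u⁻¹`, with `ρ(u)` read in `G` or in `G^φ`, is an injective
homomorphism on `Υ₁(G)` (`shear`). Its image is `Υ₂(G)`, respectively `Υ₃(G)`. To see this, let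
`p₁`, `p₂ : ν(G) → G` (`fstHom`, `sndHom`) kill `G^φ`, respectively `G`, and be the identity on the
other copy. Then
`Υ₁ = ker p₁ ∩ ker p₂`, every `x` is `u p₁(x) p₂(x)^φ` with `u` in `Υ₁`, and
`ker ρ ∩ ker p₂` is both contained in the image of the first map and contains `Υ₂`.

That `Υ₂` and `Υ₃` commute rests on the identity `[[x, y], b^φ] = [[x, y^φ], b^φ]`
(`cm_cm_ofPhi`), by which `G^φ` centralises `Υ₂`. Modulo `Υ₁ Υ₂ Υ₃` the group `ν(G)` is abelian
(`commutator_le_sup`). Finally `(p₁, p₂, ρ)` maps `ν(G)'` onto `G' × G' × G'`, the three factors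
being the images of `Υ₂`, `Υ₃` and `Υ₁`, and has kernel `Υ₁ ∩ Θ = μ(G)`.
-/

namespace NuGroup

open scoped commutatorElement

variable {G : Type*} [Group G]

/-! ### The non-abelian tensor square -/

/-- The generator `g ⊗ h` of the non-abelian tensor square. -/
def tmul (g h : G) : TensorSquare G := PresentedGroup.of (g, h)

theorem mul_tmul (g g₁ h : G) :
    tmul (g * g₁) h = tmul (cj g g₁) (cj h g₁) * tmul g₁ h := by
  have := PresentedGroup.one_of_mem (rels := {r | IsTensorRelator G r}) (.left g g₁ h)
  rw [map_mul, map_inv, mul_inv_eq_one, map_mul] at this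
  exact this

theorem tmul_mul (g h h₁ : G) :
    tmul g (h * h₁) = tmul g h₁ * tmul (cj g h₁) (cj h h₁) := by
  have := PresentedGroup.one_of_mem (rels := {r | IsTensorRelator G r}) (.right g h h₁)
  rw [map_mul, map_inv, mul_inv_eq_one, map_mul] at this
  exact this

/-- A map on the generators `g ⊗ h` respecting the tensor relations extends to `G ⊗ G`. -/
def tensorLift {H : Type*} [Group H] (f : G → G → H)
    (hl : ∀ g g₁ h, f (g * g₁) h = f (cj g g₁) (cj h g₁) * f g₁ h)
    (hr : ∀ g h h₁, f g (h * h₁) = f g h₁ * f (cj g h₁) (cj h h₁)) : TensorSquare G →* H :=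
  PresentedGroup.toGroup (f := fun p => f p.1 p.2) <| by
    rintro _ (⟨g, g₁, h⟩ | ⟨g, h, h₁⟩)
    · simp [hl g g₁ h]
    · simp [hr g h h₁]

@[simp]
theorem tensorLift_tmul {H : Type*} [Group H] (f : G → G → H) (hl hr) (g h : G) :
    tensorLift f hl hr (tmul g h) = f g h :=
  PresentedGroup.toGroup.of _

theorem tensor_hom_ext {H : Type*} [Group H] {f f' : TensorSquare G →* H}
    (h : ∀ a b, f (tmul a b) = f' (tmul a b)) : f = f' :=
  PresentedGroup.ext fun p => h p.1 p.2

theorem tensor_induction {p : TensorSquare G → Prop} (one : p 1)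
    (mul : ∀ s t, p s → p t → p (s * t)) (inv : ∀ t, p t → p t⁻¹)
    (of : ∀ g h, p (tmul g h)) (t : TensorSquare G) : p t := by
  have ht : t ∈ Subgroup.closure
      (Set.range (PresentedGroup.of (rels := {r | IsTensorRelator G r}))) := by
    rw [PresentedGroup.closure_range_of]; trivial
  induction ht using Subgroup.closure_induction with
  | mem x hx => obtain ⟨⟨g, h⟩, rfl⟩ := hx; exact of g h
  | one => exact one
  | mul x y _ _ hx hy => exact mul x y hx hy
  | inv x _ hx => exact inv x hx

/-- An action of a group by endomorphisms is an action by automorphisms. -/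
def autOfEnd {N : Type*} [Group N] (F : G →* Monoid.End N) : G →* MulAut N where
  toFun g := MonoidHom.toMulEquiv (F g) (F g⁻¹)
    (by change F g⁻¹ * F g = 1; rw [← map_mul, inv_mul_cancel, map_one])
    (by change F g * F g⁻¹ = 1; rw [← map_mul, mul_inv_cancel, map_one])
  map_one' := by ext x; change F 1 x = x; rw [map_one]; rfl
  map_mul' a b := by ext x; change F (a * b) x = F a (F b x); rw [map_mul]; rfl

/-- The endomorphism `g ⊗ h ↦ x g x⁻¹ ⊗ x h x⁻¹` of `G ⊗ G`. -/
def tensorConj (x : G) : TensorSquare G →* TensorSquare G :=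
  tensorLift (fun g h => tmul (x * g * x⁻¹) (x * h * x⁻¹))
    (fun g g₁ h => by
      rw [show x * (g * g₁) * x⁻¹ = (x * g * x⁻¹) * (x * g₁ * x⁻¹) by group, mul_tmul]
      simp only [cj]; congr 2 <;> group)
    (fun g h h₁ => by
      rw [show x * (h * h₁) * x⁻¹ = (x * h * x⁻¹) * (x * h₁ * x⁻¹) by group, tmul_mul]
      simp only [cj]; congr 2 <;> group)

theorem tensorConj_tmul (x g h : G) :
    tensorConj x (tmul g h) = tmul (x * g * x⁻¹) (x * h * x⁻¹) :=
  tensorLift_tmul _ _ _ _ _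

/-- The diagonal conjugation action of `G` on `G ⊗ G`, as a left action by endomorphisms. -/
def tensorEnd : G →* Monoid.End (TensorSquare G) where
  toFun := tensorConj
  map_one' := tensor_hom_ext fun a b => by
    change _ = tmul a b
    simp [tensorConj_tmul]
  map_mul' x y := tensor_hom_ext fun a b => by
    change _ = tensorConj x (tensorConj y (tmul a b))
    simp [tensorConj_tmul, mul_assoc]

/-- The diagonal conjugation action of `G` on `G ⊗ G` by automorphisms. -/
def tensorAct : G →* MulAut (TensorSquare G) := autOfEnd tensorEnd

theorem tensorAct_tmul (x g h : G) :
    tensorAct x (tmul g h) = tmul (x * g * x⁻¹) (x * h * x⁻¹) :=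
  tensorConj_tmul x g h

theorem tensorAct_inv_tmul (x g h : G) :
    tensorAct x⁻¹ (tmul g h) = tmul (cj g x) (cj h x) := by
  rw [tensorAct_tmul, inv_inv]; rfl

theorem mul_tmul' (g g₁ h : G) :
    tmul (g * g₁) h = tensorAct g₁⁻¹ (tmul g h) * tmul g₁ h := by
  rw [tensorAct_inv_tmul, mul_tmul]

theorem tmul_mul' (g h h₁ : G) :
    tmul g (h * h₁) = tmul g h₁ * tensorAct h₁⁻¹ (tmul g h) := by
  rw [tensorAct_inv_tmul, tmul_mul]

/-- The two expansions of `g g₁ ⊗ h h₁`, by the left and by the right factor first, agree. -/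
theorem tensorAct_mul_tmul (g h g₁ h₁ : G) :
    tensorAct (h₁ * g₁)⁻¹ (tmul g h) * tmul g₁ h₁ =
      tmul g₁ h₁ * tensorAct (g₁ * h₁)⁻¹ (tmul g h) := by
  have e₁ := mul_tmul' g g₁ (h * h₁)
  have e₂ := tmul_mul' (g * g₁) h h₁
  rw [tmul_mul' g h h₁, tmul_mul' g₁ h h₁] at e₁
  rw [mul_tmul' g g₁ h, mul_tmul' g g₁ h₁] at e₂
  have e := e₁.symm.trans e₂
  simp only [map_mul, mul_assoc, mul_right_inj] at e
  simp only [← mul_assoc, mul_left_inj] at e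
  simpa only [mul_inv_rev, map_mul, MulAut.mul_apply] using e

/-- Conjugation by a generator `g ⊗ h` is the action of the commutator `[g, h]`
(the Peiffer identity). -/
theorem conj_tmul (s : TensorSquare G) (g h : G) :
    (tmul g h)⁻¹ * s * tmul g h = tensorAct (cm g h)⁻¹ s := by
  suffices H : (MulAut.conj (tmul g h)⁻¹).toMonoidHom = (tensorAct (cm g h)⁻¹).toMonoidHom by
    simpa using DFunLike.congr_fun H s
  refine tensor_hom_ext fun a b => ?_
  -- The generator is pre-translated by `h g`, so that one of the two actions becomes trivial.
  have := tensorAct_mul_tmul (h * g * a * (h * g)⁻¹) (h * g * b * (h * g)⁻¹) g h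
  rw [← tensorAct_tmul, ← MulAut.mul_apply, ← MulAut.mul_apply, ← map_mul, ← map_mul,
    inv_mul_cancel, map_one, MulAut.one_apply] at this
  simp only [MulEquiv.toMonoidHom_eq_coe, MonoidHom.coe_coe, MulAut.conj_apply, inv_inv, mul_assoc,
    this, inv_mul_cancel_left]
  congr 2
  simp only [cm, cj]; group

/-! ### A model of `ν(G)` and the embedding of `G ⊗ G` -/

/-- The semidirect product `(G ⊗ G) ⋊ G`, a model of the normal closure of `G` in `ν(G)`. -/
abbrev TensorSemi (G : Type*) [Group G] : Type _ := TensorSquare G ⋊[tensorAct] G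

theorem tensorSemi_conj (x : G) (t : TensorSquare G) :
    (SemidirectProduct.inr x : TensorSemi G)⁻¹ * SemidirectProduct.inl t * SemidirectProduct.inr x =
      SemidirectProduct.inl (tensorAct x⁻¹ t) := by
  rw [SemidirectProduct.inl_aut]; simp

/-- The homomorphism `g ↦ g (g ⊗ b)`, which models `g ↦ g ^ (b^φ) = g [g, b^φ]`. -/
def twist (b : G) : G →* TensorSemi G where
  toFun g := SemidirectProduct.inr g * SemidirectProduct.inl (tmul g b)
  map_one' := by
    have h := mul_tmul' (1 : G) 1 b
    simp only [mul_one, inv_one, map_one, MulAut.one_apply, left_eq_mul] at h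
    simp [h]
  map_mul' g g₁ := by
    rw [mul_tmul', map_mul, map_mul, ← tensorSemi_conj]; group

/-- The endomorphism of `(G ⊗ G) ⋊ G` that models `x ↦ b^φ x (b^φ)⁻¹`. It respects the action of `G`
on `G ⊗ G` by the Peiffer identity `conj_tmul`. -/
def semiEndAux (b : G) : Monoid.End (TensorSemi G) :=
  SemidirectProduct.lift (SemidirectProduct.inl.comp (tensorAct b).toMonoidHom) (twist b⁻¹) <| by
    intro g
    refine MonoidHom.ext fun t => ?_
    have h : tmul g b⁻¹ * tensorAct b t * (tmul g b⁻¹)⁻¹ =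
        tensorAct g⁻¹ (tensorAct b (tensorAct g t)) := by
      rw [mul_inv_eq_iff_eq_mul, ← eq_inv_mul_iff_mul_eq, ← mul_assoc, conj_tmul]
      simp only [← MulAut.mul_apply, ← map_mul]
      congr 2
      simp only [cm, cj]; group
    change SemidirectProduct.inl (tensorAct b (tensorAct g t)) =
      SemidirectProduct.inr g * SemidirectProduct.inl (tmul g b⁻¹) *
        SemidirectProduct.inl (tensorAct b t) *
        (SemidirectProduct.inr g * SemidirectProduct.inl (tmul g b⁻¹))⁻¹
    have h' := congrArg (SemidirectProduct.inl (φ := tensorAct (G := G))) h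
    rw [← tensorSemi_conj, map_mul, map_mul, map_inv] at h'
    have h'' := congrArg (fun y => SemidirectProduct.inr g * y * (SemidirectProduct.inr g)⁻¹) h'
    simpa only [mul_assoc, mul_inv_rev, mul_inv_cancel, mul_inv_cancel_left, mul_one]
      using h''.symm

theorem semiEndAux_inl (b : G) (t : TensorSquare G) :
    semiEndAux b (SemidirectProduct.inl t) = SemidirectProduct.inl (tensorAct b t) :=
  SemidirectProduct.lift_inl _ _ _ _

theorem semiEndAux_inr (b g : G) :
    semiEndAux b (SemidirectProduct.inr g) =
      SemidirectProduct.inr g * SemidirectProduct.inl (tmul g b⁻¹) :=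
  SemidirectProduct.lift_inr _ _ _ _

theorem tmul_one (g : G) : tmul g 1 = 1 := by
  have h := tmul_mul' g 1 1
  simpa using h

/-- The action of `G^φ` on `(G ⊗ G) ⋊ G` by conjugation, as endomorphisms. -/
def semiEnd : G →* Monoid.End (TensorSemi G) where
  toFun := semiEndAux
  map_one' := by
    apply SemidirectProduct.hom_ext
    · refine MonoidHom.ext fun t => ?_
      change semiEndAux 1 (SemidirectProduct.inl t) = SemidirectProduct.inl t
      simp [semiEndAux_inl]
    · refine MonoidHom.ext fun g => ?_
      change semiEndAux 1 (SemidirectProduct.inr g) = SemidirectProduct.inr g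
      simp [semiEndAux_inr, tmul_one]
  map_mul' b c := by
    apply SemidirectProduct.hom_ext
    · refine MonoidHom.ext fun t => ?_
      change semiEndAux (b * c) (SemidirectProduct.inl t) =
        semiEndAux b (semiEndAux c (SemidirectProduct.inl t))
      simp [semiEndAux_inl]
    · refine MonoidHom.ext fun g => ?_
      change semiEndAux (b * c) (SemidirectProduct.inr g) =
        semiEndAux b (semiEndAux c (SemidirectProduct.inr g))
      rw [semiEndAux_inr, semiEndAux_inr, map_mul, semiEndAux_inr, semiEndAux_inl, mul_inv_rev,
        tmul_mul', inv_inv, map_mul, mul_assoc]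

/-- The model `((G ⊗ G) ⋊ G) ⋊ G` of `ν(G)`; the outer factor is `G^φ`. -/
abbrev NuModel (G : Type*) [Group G] : Type _ := TensorSemi G ⋊[autOfEnd (semiEnd (G := G))] G

/-- The inclusion of `G ⊗ G` in the model of `ν(G)`. -/
def modelTensor : TensorSquare G →* NuModel G :=
  SemidirectProduct.inl.comp SemidirectProduct.inl

theorem modelTensor_injective : Function.Injective (modelTensor (G := G)) :=
  SemidirectProduct.inl_injective.comp SemidirectProduct.inl_injective

/-- The copy of `G` in the model of `ν(G)`. -/
def modelG : G →* NuModel G := SemidirectProduct.inl.comp SemidirectProduct.inr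

/-- The copy of `G^φ` in the model of `ν(G)`. -/
def modelPhi : G →* NuModel G := SemidirectProduct.inr

theorem modelPhi_conj (b : G) (x : TensorSemi G) :
    cj (SemidirectProduct.inl x) (modelPhi b) = SemidirectProduct.inl (semiEndAux b⁻¹ x) := by
  have := SemidirectProduct.inl_aut (φ := autOfEnd (semiEnd (G := G))) b⁻¹ x
  rw [inv_inv] at this
  rw [cj, modelPhi, ← map_inv]
  exact this.symm

theorem modelTensor_conj_phi (b : G) (t : TensorSquare G) :
    cj (modelTensor t) (modelPhi b) = modelTensor (tensorAct b⁻¹ t) := by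
  simp [modelTensor, modelPhi_conj, semiEndAux_inl]

theorem modelTensor_conj_G (g : G) (t : TensorSquare G) :
    cj (modelTensor t) (modelG g) = modelTensor (tensorAct g⁻¹ t) := by
  rw [modelTensor, MonoidHom.comp_apply, MonoidHom.comp_apply, ← tensorSemi_conj]
  simp [modelG, cj]

theorem model_commutator (g h : G) : cm (modelG g) (modelPhi h) = modelTensor (tmul g h) := by
  simp only [cm, modelG, MonoidHom.comp_apply, modelPhi_conj, semiEndAux_inr, inv_inv]
  simp [modelTensor]

/-- The map from `ν(G)` to its model. -/
def toModel : Nu G →* NuModel G :=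
  QuotientGroup.lift _ (Monoid.Coprod.lift modelG modelPhi) <|
    (Subgroup.normalClosure_le_normal (N := (Monoid.Coprod.lift modelG modelPhi).ker) (by
      rintro _ (⟨g₁, g₂, g₃⟩ | ⟨g₁, g₂, g₃⟩)
      · change Monoid.Coprod.lift modelG modelPhi _ = 1
        rw [map_mul, map_inv, mul_inv_eq_one]
        have := modelTensor_conj_G g₃ (tmul g₁ g₂)
        rw [tensorAct_inv_tmul, ← model_commutator, ← model_commutator] at this
        simpa [cm, cj] using this
      · change Monoid.Coprod.lift modelG modelPhi _ = 1
        rw [map_mul, map_inv, mul_inv_eq_one]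
        have := modelTensor_conj_phi g₃ (tmul g₁ g₂)
        rw [tensorAct_inv_tmul, ← model_commutator, ← model_commutator] at this
        simpa [cm, cj] using this.symm) : _ ≤ _)

theorem toModel_ofG (g : G) : toModel (ofG G g) = modelG g := by
  simp [toModel, ofG]

theorem toModel_ofPhi (g : G) : toModel (ofPhi G g) = modelPhi g := by
  simp [toModel, ofPhi]

theorem conj_commutator_ofG (g₁ g₂ g₃ : G) :
    cj (cm (ofG G g₁) (ofPhi G g₂)) (ofG G g₃) =
      cm (ofG G (cj g₁ g₃)) (ofPhi G (cj g₂ g₃)) := by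
  have := (QuotientGroup.eq_one_iff (N := Subgroup.normalClosure {r | IsNuRelator G r}) _).2
    (Subgroup.subset_normalClosure (IsNuRelator.left g₁ g₂ g₃))
  exact mul_inv_eq_one.1 this

theorem conj_commutator_ofPhi (g₁ g₂ g₃ : G) :
    cj (cm (ofG G g₁) (ofPhi G g₂)) (ofPhi G g₃) =
      cm (ofG G (cj g₁ g₃)) (ofPhi G (cj g₂ g₃)) := by
  have := (QuotientGroup.eq_one_iff (N := Subgroup.normalClosure {r | IsNuRelator G r}) _).2
    (Subgroup.subset_normalClosure (IsNuRelator.right g₁ g₂ g₃))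
  exact (mul_inv_eq_one.1 this).symm

/-- The map `G ⊗ G → ν(G)`, `g ⊗ h ↦ [g, h^φ]`. -/
def tensorToNu : TensorSquare G →* Nu G :=
  tensorLift (fun g h => cm (ofG G g) (ofPhi G h))
    (fun g g₁ h => by
      rw [← conj_commutator_ofG]; simp only [cm, cj, map_mul]; group)
    (fun g h h₁ => by
      rw [← conj_commutator_ofPhi]; simp only [cm, cj, map_mul]; group)

/-- Composed with the map to the model, `g ⊗ h ↦ [g, h^φ]` is an inclusion. -/
theorem tensorToNu_injective : Function.Injective (tensorToNu (G := G)) := by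
  have h : (toModel (G := G)).comp tensorToNu = modelTensor := tensor_hom_ext fun a b => by
    rw [MonoidHom.comp_apply, tensorToNu, tensorLift_tmul, ← model_commutator, cm, cj, cm, cj]
    simp [toModel_ofG, toModel_ofPhi]
  have h' := modelTensor_injective (G := G)
  rw [← h, MonoidHom.coe_comp] at h'
  exact h'.of_comp

theorem range_tensorToNu : (tensorToNu (G := G)).range = Upsilon₁ G := by
  apply le_antisymm
  · rintro _ ⟨t, rfl⟩
    induction t using tensor_induction with
    | one => rw [map_one]; exact one_mem _
    | mul s t hs ht => rw [map_mul]; exact mul_mem hs ht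
    | inv t ht => rw [map_inv]; exact inv_mem ht
    | of g h =>
      rw [tensorToNu, tensorLift_tmul]
      have := Subgroup.commutator_mem_commutator (H₁ := (ofG G).range) (H₂ := (ofPhi G).range)
        ⟨g⁻¹, rfl⟩ ⟨h⁻¹, rfl⟩
      simpa [commutatorElement_def, cm, cj, mul_assoc, Upsilon₁] using this
  · refine Subgroup.commutator_le.2 ?_
    rintro _ ⟨g, rfl⟩ _ ⟨h, rfl⟩
    refine ⟨tmul g⁻¹ h⁻¹, ?_⟩
    rw [tensorToNu, tensorLift_tmul]
    simp [commutatorElement_def, cm, cj, mul_assoc]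

theorem nu_hom_ext {H : Type*} [Group H] {f f' : Nu G →* H}
    (h : ∀ g, f (ofG G g) = f' (ofG G g)) (h' : ∀ g, f (ofPhi G g) = f' (ofPhi G g)) : f = f' :=
  QuotientGroup.monoidHom_ext _ <| Monoid.Coprod.hom_ext (MonoidHom.ext h) (MonoidHom.ext h')

theorem nu_induction {p : Nu G → Prop} (ofG : ∀ g, p (ofG G g)) (ofPhi : ∀ g, p (ofPhi G g))
    (mul : ∀ x y, p x → p y → p (x * y)) (x : Nu G) : p x := by
  induction x using QuotientGroup.induction_on with
  | H w =>
    induction w using Monoid.Coprod.induction_on with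
    | inl g => exact ofG g
    | inr g => exact ofPhi g
    | mul x y hx hy => exact mul _ _ hx hy

/-! ### The projections of `ν(G)` -/

/-- The map `ν(G) → G` with `g ↦ g` and `g^φ ↦ 1`. -/
def fstHom : Nu G →* G :=
  QuotientGroup.lift _ (Monoid.Coprod.lift (MonoidHom.id G) 1) <|
    (Subgroup.normalClosure_le_normal
      (N := (Monoid.Coprod.lift (MonoidHom.id G) (1 : G →* G)).ker) (by
        rintro _ (⟨g₁, g₂, g₃⟩ | ⟨g₁, g₂, g₃⟩) <;>
          simp [cj, cm, MonoidHom.mem_ker, mul_assoc]) : _ ≤ _)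

/-- The map `ν(G) → G` with `g ↦ 1` and `g^φ ↦ g`. -/
def sndHom : Nu G →* G :=
  QuotientGroup.lift _ (Monoid.Coprod.lift 1 (MonoidHom.id G)) <|
    (Subgroup.normalClosure_le_normal
      (N := (Monoid.Coprod.lift (1 : G →* G) (MonoidHom.id G)).ker) (by
        rintro _ (⟨g₁, g₂, g₃⟩ | ⟨g₁, g₂, g₃⟩) <;>
          simp [cj, cm, MonoidHom.mem_ker, mul_assoc]) : _ ≤ _)

@[simp] theorem fstHom_ofG (g : G) : fstHom (ofG G g) = g := by simp [fstHom, ofG]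
@[simp] theorem fstHom_ofPhi (g : G) : fstHom (ofPhi G g) = 1 := by simp [fstHom, ofPhi]
@[simp] theorem sndHom_ofG (g : G) : sndHom (ofG G g) = 1 := by simp [sndHom, ofG]
@[simp] theorem sndHom_ofPhi (g : G) : sndHom (ofPhi G g) = g := by simp [sndHom, ofPhi]

attribute [simp] rho_ofG rho_ofPhi

theorem tensorToNu_tmul (g h : G) : tensorToNu (tmul g h) = cm (ofG G g) (ofPhi G h) :=
  tensorLift_tmul _ _ _ _ _

@[simp] theorem fstHom_tensorToNu (t : TensorSquare G) : fstHom (tensorToNu t) = 1 := by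
  have : fstHom.comp (tensorToNu (G := G)) = 1 :=
    tensor_hom_ext fun a b => by simp [tensorToNu_tmul, cm, cj]
  exact DFunLike.congr_fun this t

@[simp] theorem sndHom_tensorToNu (t : TensorSquare G) : sndHom (tensorToNu t) = 1 := by
  have : sndHom.comp (tensorToNu (G := G)) = 1 :=
    tensor_hom_ext fun a b => by simp [tensorToNu_tmul, cm, cj]
  exact DFunLike.congr_fun this t

/-- Conjugation of `Υ₁(G)` by `x` is the diagonal action of `ρ(x)`. -/
theorem tensorToNu_conj (x : Nu G) (t : TensorSquare G) :
    x⁻¹ * tensorToNu t * x = tensorToNu (tensorAct (rho G x)⁻¹ t) := by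
  induction x using nu_induction generalizing t with
  | ofG g =>
    have : (MulAut.conj (ofG G g)⁻¹).toMonoidHom.comp tensorToNu =
        tensorToNu.comp (tensorAct g⁻¹).toMonoidHom := tensor_hom_ext fun a b => by
      change (MulAut.conj (ofG G g)⁻¹) (tensorToNu (tmul a b)) =
        tensorToNu (tensorAct g⁻¹ (tmul a b))
      rw [tensorAct_inv_tmul, tensorToNu_tmul, tensorToNu_tmul, ← conj_commutator_ofG,
        MulAut.conj_apply, inv_inv, cj]
    simpa using DFunLike.congr_fun this t
  | ofPhi g =>
    have : (MulAut.conj (ofPhi G g)⁻¹).toMonoidHom.comp tensorToNu =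
        tensorToNu.comp (tensorAct g⁻¹).toMonoidHom := tensor_hom_ext fun a b => by
      change (MulAut.conj (ofPhi G g)⁻¹) (tensorToNu (tmul a b)) =
        tensorToNu (tensorAct g⁻¹ (tmul a b))
      rw [tensorAct_inv_tmul, tensorToNu_tmul, tensorToNu_tmul, ← conj_commutator_ofPhi,
        MulAut.conj_apply, inv_inv, cj]
    simpa using DFunLike.congr_fun this t
  | mul x y hx hy =>
    have : (x * y)⁻¹ * tensorToNu t * (x * y) = y⁻¹ * (x⁻¹ * tensorToNu t * x) * y := by group
    rw [this, hx, hy, map_mul, mul_inv_rev, map_mul, MulAut.mul_apply]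

theorem tensorToNu_conj_congr {x y : Nu G} (h : rho G x = rho G y) (t : TensorSquare G) :
    x⁻¹ * tensorToNu t * x = y⁻¹ * tensorToNu t * y := by
  rw [tensorToNu_conj, tensorToNu_conj, h]

/-- `Θ(G)` centralises `Υ₁(G)`. -/
theorem commute_tensorToNu {s : Nu G} (hs : rho G s = 1) (t : TensorSquare G) :
    Commute (tensorToNu t) s := by
  have := tensorToNu_conj s t
  rw [hs, inv_one, map_one, MulAut.one_apply, mul_assoc, inv_mul_eq_iff_eq_mul] at this
  exact this

instance : (Upsilon₁ G).Normal := by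
  rw [← range_tensorToNu]
  refine ⟨?_⟩
  rintro _ ⟨t, rfl⟩ x
  have := tensorToNu_conj x⁻¹ t
  rw [inv_inv] at this
  exact ⟨_, this.symm⟩

/-- Modulo `Υ₁(G)`, the group `ν(G)` is `G × G`. -/
theorem exists_tensorToNu_mul (x : Nu G) :
    ∃ t, x = tensorToNu t * ofG G (fstHom x) * ofPhi G (sndHom x) := by
  let π := QuotientGroup.mk' (Upsilon₁ G)
  have hc (g h : G) : Commute (π (ofG G g)) (π (ofPhi G h)) := by
    rw [← commutatorElement_eq_one_iff_commute, ← map_commutatorElement]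
    exact (QuotientGroup.eq_one_iff _).2
      (Subgroup.commutator_mem_commutator ⟨g, rfl⟩ ⟨h, rfl⟩)
  have H : π = (MonoidHom.noncommCoprod (π.comp (ofG G)) (π.comp (ofPhi G)) hc).comp
      (fstHom.prod sndHom) := nu_hom_ext (by simp) (by simp)
  have hx : π x = π (ofG G (fstHom x) * ofPhi G (sndHom x)) := by
    rw [map_mul]; exact DFunLike.congr_fun H x
  have hm : x * (ofG G (fstHom x) * ofPhi G (sndHom x))⁻¹ ∈ Upsilon₁ G := by
    rw [← QuotientGroup.eq_one_iff]
    change π _ = 1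
    rw [map_mul, map_inv, hx, mul_inv_cancel]
  rw [← range_tensorToNu] at hm
  obtain ⟨t, ht⟩ := hm
  exact ⟨t, by rw [ht]; group⟩

theorem Upsilon₁_eq : Upsilon₁ G = fstHom.ker ⊓ sndHom.ker := by
  rw [← range_tensorToNu]
  ext x
  constructor
  · rintro ⟨t, rfl⟩
    exact ⟨fstHom_tensorToNu t, sndHom_tensorToNu t⟩
  · rintro ⟨h, h'⟩
    obtain ⟨t, ht⟩ := exists_tensorToNu_mul x
    rw [h, h', map_one, map_one, mul_one, mul_one] at ht
    exact ⟨t, ht.symm⟩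

/-! ### The subgroups `Υ₂(G)` and `Υ₃(G)` -/

/-- For a section `ι` of `ρ`, the map `t ↦ ι(ρ(u)) u⁻¹`, where `u` is the image of `t` in
`Υ₁(G)`. It is multiplicative because its values lie in `Θ(G)`, which centralises `Υ₁(G)`. -/
def shear (ι : G →* Nu G) (hι : ∀ g, rho G (ι g) = g) : TensorSquare G →* Nu G where
  toFun t := ι (rho G (tensorToNu t)) * (tensorToNu t)⁻¹
  map_one' := by simp
  map_mul' s t := by
    have h : Commute (tensorToNu s) (ι (rho G (tensorToNu t)) * (tensorToNu t)⁻¹) :=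
      commute_tensorToNu (by rw [map_mul, hι, map_inv, mul_inv_cancel]) s
    rw [map_mul, map_mul, map_mul, mul_inv_rev, mul_assoc, ← mul_assoc (ι (rho G (tensorToNu t))),
      h.inv_left.eq.symm, mul_assoc]

theorem shear_apply (ι : G →* Nu G) (hι : ∀ g, rho G (ι g) = g) (t : TensorSquare G) :
    shear ι hι t = ι (rho G (tensorToNu t)) * (tensorToNu t)⁻¹ := rfl

@[simp] theorem rho_shear (ι : G →* Nu G) (hι : ∀ g, rho G (ι g) = g) (t : TensorSquare G) :
    rho G (shear ι hι t) = 1 := by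
  rw [shear_apply, map_mul, hι, map_inv, mul_inv_cancel]

/-- If `ι(ρ(u)) = u` with `u` in `Υ₁(G)`, then a retraction `q` of `ι` that kills `Υ₁(G)` shows
`ρ(u) = 1`, hence `u = 1`. -/
theorem shear_injective (ι : G →* Nu G) (hι : ∀ g, rho G (ι g) = g) (q : Nu G →* G)
    (hq : ∀ g, q (ι g) = g) (hq' : ∀ t, q (tensorToNu t) = 1) :
    Function.Injective (shear ι hι) := by
  refine (injective_iff_map_eq_one _).2 fun t ht => tensorToNu_injective ?_
  have h := congrArg q ht
  rw [shear_apply, map_mul, hq, map_inv, hq', inv_one, mul_one, map_one] at h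
  rw [shear_apply, h, map_one, one_mul, inv_eq_one] at ht
  rw [ht, map_one]

theorem shear_ofG_tmul (x y : G) : shear (ofG G) (rho_ofG G) (tmul x y) =
    cm (ofG G x) (ofG G y) * (cm (ofG G x) (ofPhi G y))⁻¹ := by
  simp [shear_apply, tensorToNu_tmul, cm, cj]

theorem shear_ofPhi_tmul (x y : G) : shear (ofPhi G) (rho_ofPhi G) (tmul x y) =
    cm (ofPhi G x) (ofPhi G y) * (cm (ofG G x) (ofPhi G y))⁻¹ := by
  simp [shear_apply, tensorToNu_tmul, cm, cj]

theorem shear_mem_of_tmul {ι : G →* Nu G} {hι : ∀ g, rho G (ι g) = g} {K : Subgroup (Nu G)}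
    (h : ∀ x y, shear ι hι (tmul x y) ∈ K) (t : TensorSquare G) : shear ι hι t ∈ K := by
  induction t using tensor_induction with
  | one => rw [map_one]; exact one_mem _
  | mul s t hs ht => rw [map_mul]; exact mul_mem hs ht
  | inv t ht => rw [map_inv]; exact inv_mem ht
  | of x y => exact h x y

/-- Each generator `[x, y] [x, y^φ]⁻¹` of the image is a commutator of an element of `G` with an
element of `Θ(G)`. -/
theorem shear_ofG_mem (t : TensorSquare G) : shear (ofG G) (rho_ofG G) t ∈ Upsilon₂ G := by
  refine shear_mem_of_tmul (fun x y => ?_) t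
  have h := Subgroup.commutator_mem_commutator (H₁ := (ofG G).range) (H₂ := Theta G)
    (g₁ := ofG G (x⁻¹ * y⁻¹ * x * y * x)) ⟨_, rfl⟩
    (g₂ := (ofG G x)⁻¹ * (ofPhi G y)⁻¹ * ofG G y * ofG G x) (by simp [Theta, MonoidHom.mem_ker])
  rw [Subgroup.commutator_comm] at h
  change _ ∈ ⁅Theta G, (ofG G).range⁆
  convert h using 1
  rw [shear_ofG_tmul, commutatorElement_def]
  simp only [cm, cj, map_mul, map_inv]
  group

/-- Each generator `[x^φ, y^φ] [x, y^φ]⁻¹` of the image is a commutator of an element of `G^φ` with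
an element of `Θ(G)`. -/
theorem shear_ofPhi_mem (t : TensorSquare G) : shear (ofPhi G) (rho_ofPhi G) t ∈ Upsilon₃ G := by
  refine shear_mem_of_tmul (fun x y => ?_) t
  have h := Subgroup.commutator_mem_commutator (H₁ := (ofPhi G).range) (H₂ := Theta G)
    (g₁ := ofPhi G (x⁻¹ * y⁻¹ * x)) ⟨_, rfl⟩
    (g₂ := (ofG G x)⁻¹ * ofPhi G x) (by simp [Theta, MonoidHom.mem_ker])
  rw [Subgroup.commutator_comm] at h
  change _ ∈ ⁅Theta G, (ofPhi G).range⁆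
  convert h using 1
  rw [shear_ofPhi_tmul, commutatorElement_def]
  simp only [cm, cj, map_mul, map_inv]
  group

theorem Upsilon₂_le : Upsilon₂ G ≤ Theta G ⊓ sndHom.ker := by
  refine Subgroup.commutator_le.2 ?_
  rintro s (hs : rho G s = 1) _ ⟨g, rfl⟩
  constructor
  · change rho G _ = 1
    simp [hs, commutatorElement_def]
  · change sndHom _ = 1
    simp [commutatorElement_def]

theorem Upsilon₃_le : Upsilon₃ G ≤ Theta G ⊓ fstHom.ker := by
  refine Subgroup.commutator_le.2 ?_
  rintro s (hs : rho G s = 1) _ ⟨g, rfl⟩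
  constructor
  · change rho G _ = 1
    simp [hs, commutatorElement_def]
  · change fstHom _ = 1
    simp [commutatorElement_def]

/-- In the decomposition `x = u g h^φ` of an element with `ρ(x) = 1` and `h = 1`, the factor
`g` is `ρ(u)⁻¹`. -/
theorem le_range_shear_ofG : Theta G ⊓ sndHom.ker ≤ (shear (ofG G) (rho_ofG G)).range := by
  rintro x ⟨hx : rho G x = 1, hx' : sndHom x = 1⟩
  obtain ⟨t, ht⟩ := exists_tensorToNu_mul x
  rw [hx', map_one, mul_one] at ht
  have h : rho G (tensorToNu t) = (fstHom x)⁻¹ := by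
    rw [ht, map_mul, rho_ofG] at hx
    exact eq_inv_of_mul_eq_one_left hx
  refine ⟨t⁻¹, ?_⟩
  rw [map_inv, shear_apply, h, mul_inv_rev, inv_inv, map_inv, inv_inv]
  exact ht.symm

theorem le_range_shear_ofPhi : Theta G ⊓ fstHom.ker ≤ (shear (ofPhi G) (rho_ofPhi G)).range := by
  rintro x ⟨hx : rho G x = 1, hx' : fstHom x = 1⟩
  obtain ⟨t, ht⟩ := exists_tensorToNu_mul x
  rw [hx', map_one, mul_one] at ht
  have h : rho G (tensorToNu t) = (sndHom x)⁻¹ := by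
    rw [ht, map_mul, rho_ofPhi] at hx
    exact eq_inv_of_mul_eq_one_left hx
  refine ⟨t⁻¹, ?_⟩
  rw [map_inv, shear_apply, h, mul_inv_rev, inv_inv, map_inv, inv_inv]
  exact ht.symm

theorem range_shear_ofG : (shear (ofG G) (rho_ofG G)).range = Upsilon₂ G :=
  le_antisymm (by rintro _ ⟨t, rfl⟩; exact shear_ofG_mem t)
    (Upsilon₂_le.trans le_range_shear_ofG)

theorem range_shear_ofPhi : (shear (ofPhi G) (rho_ofPhi G)).range = Upsilon₃ G :=
  le_antisymm (by rintro _ ⟨t, rfl⟩; exact shear_ofPhi_mem t)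
    (Upsilon₃_le.trans le_range_shear_ofPhi)

theorem Upsilon₂_eq : Upsilon₂ G = Theta G ⊓ sndHom.ker :=
  le_antisymm Upsilon₂_le (le_range_shear_ofG.trans range_shear_ofG.le)

theorem Upsilon₃_eq : Upsilon₃ G = Theta G ⊓ fstHom.ker :=
  le_antisymm Upsilon₃_le (le_range_shear_ofPhi.trans range_shear_ofPhi.le)

instance : (Theta G).Normal := by unfold Theta; infer_instance

instance : (Upsilon₂ G).Normal := by rw [Upsilon₂_eq]; infer_instance

instance : (Upsilon₃ G).Normal := by rw [Upsilon₃_eq]; infer_instance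

/-- The isomorphism `G ⊗ G ≅ Υ₂(G)`. -/
noncomputable def tensorEquivUpsilon₂ : TensorSquare G ≃* Upsilon₂ G :=
  (MonoidHom.ofInjective (shear_injective (ofG G) (rho_ofG G) fstHom fstHom_ofG
    fstHom_tensorToNu)).trans (MulEquiv.subgroupCongr range_shear_ofG)

/-- The isomorphism `G ⊗ G ≅ Υ₃(G)`. -/
noncomputable def tensorEquivUpsilon₃ : TensorSquare G ≃* Upsilon₃ G :=
  (MonoidHom.ofInjective (shear_injective (ofPhi G) (rho_ofPhi G) sndHom sndHom_ofPhi
    sndHom_tensorToNu)).trans (MulEquiv.subgroupCongr range_shear_ofPhi)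

/-! ### The central product decomposition -/

theorem cm_mul_left {H : Type*} [Group H] (p q c : H) :
    cm (p * q) c = q⁻¹ * cm p c * q * cm q c := by
  simp only [cm, cj]; group

/-- The identity `[[x, y], b^φ] = [[x, y^φ], b^φ]`: writing `[x, y] = x⁻¹ x^y`, both sides expand
into factors of `Υ₁(G)` conjugated by elements with the same image under `ρ`. -/
theorem cm_cm_ofPhi (x y b : G) :
    cm (cm (ofG G x) (ofG G y)) (ofPhi G b) = cm (cm (ofG G x) (ofPhi G y)) (ofPhi G b) := by
  obtain ⟨c, rfl⟩ : ∃ c, b = cj c y := ⟨y * b * y⁻¹, by simp only [cj]; group⟩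
  -- `h₁` compares the factors `[x⁻¹, b^φ]`, and `h₃` the factors `[x^y, b^φ]` and
  -- `[x^(y^φ), b^φ]`, which are conjugates of `[x, c^φ]` by `y` and by `y^φ`.
  have h₁ := tensorToNu_conj_congr (x := cj (ofG G x) (ofG G y)) (y := cj (ofG G x) (ofPhi G y))
    (by simp [cj]) (tmul x⁻¹ (cj c y))
  rw [tensorToNu_tmul, map_inv] at h₁
  have h₂ := tensorToNu_conj_congr (x := ofG G y) (y := ofPhi G y) (by simp) (tmul x c)
  rw [tensorToNu_tmul] at h₂
  have h₃ : cm (cj (ofG G x) (ofG G y)) (ofPhi G (cj c y)) =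
      cm (cj (ofG G x) (ofPhi G y)) (ofPhi G (cj c y)) := by
    have h₄ := conj_commutator_ofG x c y
    rw [cj, h₂] at h₄
    have h₅ : ofG G (cj x y) = cj (ofG G x) (ofG G y) := by simp [cj]
    rw [← h₅, ← h₄]
    simp only [cm, cj, map_mul, map_inv]; group
  change cm ((ofG G x)⁻¹ * cj (ofG G x) (ofG G y)) _ =
    cm ((ofG G x)⁻¹ * cj (ofG G x) (ofPhi G y)) _
  rw [cm_mul_left, cm_mul_left, h₁, h₃]

/-- `G^φ` centralises `Υ₂(G)`: by `cm_cm_ofPhi`, `b^φ` has the same conjugate under `[x, y]` as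
under `[x, y^φ]`. -/
theorem commute_shear_ofG_ofPhi (t : TensorSquare G) (b : G) :
    Commute (shear (ofG G) (rho_ofG G) t) (ofPhi G b) := by
  have : shear (ofG G) (rho_ofG G) t ∈ Subgroup.centralizer {ofPhi G b} := by
    refine shear_mem_of_tmul (fun x y => ?_) t
    rw [Subgroup.mem_centralizer_singleton_iff, shear_ofG_tmul]
    have h := cm_cm_ofPhi x y b
    generalize cm (ofG G x) (ofG G y) = p at h ⊢
    generalize cm (ofG G x) (ofPhi G y) = q at h ⊢
    generalize ofPhi G b = c at h ⊢
    have h' : p⁻¹ * c * p = q⁻¹ * c * q := by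
      have h₁ : c * (cm p c)⁻¹ = p⁻¹ * c * p := by simp only [cm, cj]; group
      have h₂ : c * (cm q c)⁻¹ = q⁻¹ * c * q := by simp only [cm, cj]; group
      rw [← h₁, ← h₂, h]
    calc p * q⁻¹ * c = p * (q⁻¹ * c * q) * q⁻¹ := by group
      _ = p * (p⁻¹ * c * p) * q⁻¹ := by rw [h']
      _ = c * (p * q⁻¹) := by group
  exact (Subgroup.mem_centralizer_singleton_iff.1 this)

theorem commute_Upsilon₁_Theta {x y : Nu G} (hx : x ∈ Upsilon₁ G) (hy : y ∈ Theta G) :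
    Commute x y := by
  rw [← range_tensorToNu] at hx
  obtain ⟨t, rfl⟩ := hx
  exact commute_tensorToNu hy t

/-- An element `a^φ u⁻¹` of `Υ₃(G)` is a product of elements of `G^φ` and of `Υ₁(G)`, both of which
centralise `Υ₂(G)`. -/
theorem commute_Upsilon₂_Upsilon₃ {x y : Nu G} (hx : x ∈ Upsilon₂ G) (hy : y ∈ Upsilon₃ G) :
    Commute x y := by
  rw [← range_shear_ofG] at hx
  rw [← range_shear_ofPhi] at hy
  obtain ⟨s, rfl⟩ := hx
  obtain ⟨t, rfl⟩ := hy
  rw [shear_apply (ofPhi G)]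
  exact (commute_shear_ofG_ofPhi s _).mul_right
    (commute_tensorToNu (rho_shear _ _ _) t).symm.inv_right

/-- Modulo `Υ₁(G) Υ₂(G) Υ₃(G)` the groups `G` and `G^φ` commute and `g⁻¹ g^φ` is central, so that
`[x, y] = [x, y^φ] = 1` for `x, y ∈ G`. -/
theorem commutator_le_sup : commutator (Nu G) ≤ Upsilon₁ G ⊔ Upsilon₂ G ⊔ Upsilon₃ G := by
  set N := Upsilon₁ G ⊔ Upsilon₂ G ⊔ Upsilon₃ G with hN
  let π := QuotientGroup.mk' N
  have hc {x y : Nu G} (h : ⁅x, y⁆ ∈ N) : Commute (π x) (π y) := by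
    rw [← commutatorElement_eq_one_iff_commute, ← map_commutatorElement]
    exact (QuotientGroup.eq_one_iff _).2 h
  have h₁ : Upsilon₁ G ≤ N := le_sup_left.trans le_sup_left
  have h₂ : Upsilon₂ G ≤ N := le_sup_right.trans le_sup_left
  have h₃ : Upsilon₃ G ≤ N := le_sup_right
  have hθ (y : G) : (ofG G y)⁻¹ * ofPhi G y ∈ Theta G := by simp [Theta, MonoidHom.mem_ker]
  have c₁ (x y : G) : Commute (π (ofG G x)) (π (ofPhi G y)) :=
    hc (h₁ (Subgroup.commutator_mem_commutator ⟨x, rfl⟩ ⟨y, rfl⟩))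
  have c₂ (x y : G) : Commute (π (ofG G x)) (π (ofG G y)) := by
    have h := hc (h₂ (Subgroup.commutator_mem_commutator (hθ y) ⟨x, rfl⟩))
    have h' := (c₁ x y).mul_right h.symm.inv_right
    rw [map_mul, map_inv, mul_inv_rev, inv_inv, mul_inv_cancel_left] at h'
    exact h'
  have c₃ (x y : G) : Commute (π (ofPhi G x)) (π (ofPhi G y)) := by
    have h := hc (h₃ (Subgroup.commutator_mem_commutator (hθ y) ⟨x, rfl⟩))
    have h' := (c₁ y x).symm.mul_right h.symm
    rw [map_mul, map_inv, mul_inv_cancel_left] at h'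
    exact h'
  have hπ (x : Nu G) : π x = π (ofG G (fstHom x)) * π (ofPhi G (sndHom x)) := by
    obtain ⟨t, ht⟩ := exists_tensorToNu_mul x
    have h : π (tensorToNu t) = 1 :=
      (QuotientGroup.eq_one_iff _).2 (h₁ (range_tensorToNu.le ⟨t, rfl⟩))
    conv_lhs => rw [ht, map_mul, map_mul, h, one_mul]
  rw [commutator_def]
  refine Subgroup.commutator_le.2 fun x _ y _ => ?_
  have h : Commute (π x) (π y) := by
    rw [hπ x, hπ y]
    exact ((c₂ _ _).mul_right (c₁ _ _)).mul_left ((c₁ _ _).symm.mul_right (c₃ _ _))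
  rw [← commutatorElement_eq_one_iff_commute, ← map_commutatorElement] at h
  exact (QuotientGroup.eq_one_iff _).1 h

theorem Upsilon₁_le_commutator : Upsilon₁ G ≤ commutator (Nu G) :=
  Subgroup.commutator_mono le_top le_top

theorem Upsilon₂_le_commutator : Upsilon₂ G ≤ commutator (Nu G) :=
  Subgroup.commutator_mono le_top le_top

theorem Upsilon₃_le_commutator : Upsilon₃ G ≤ commutator (Nu G) :=
  Subgroup.commutator_mono le_top le_top

/-- Pairwise commuting normal subgroups with join `⊤` form a central product: an element of
`K i` and of the join of the others commutes with the latter and with `K i`. -/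
theorem IsCentralProduct.of_commute {H ι : Type*} [Group H] {K : ι → Subgroup H}
    (normal : ∀ i, (K i).Normal) (prod_eq : ⨆ i, K i = ⊤)
    (comm : ∀ i j, i ≠ j → ∀ x ∈ K i, ∀ y ∈ K j, Commute x y) : IsCentralProduct K where
  normal := normal
  prod_eq := prod_eq
  commutator_eq i j hij := by
    rw [eq_bot_iff, Subgroup.commutator_le]
    exact fun x hx y hy => commutatorElement_eq_one_iff_commute.2 (comm i j hij x hx y hy)
  inf_le_center i := by
    rintro z ⟨hz, hz'⟩
    have h₁ : ⨆ (j) (_ : j ≠ i), K j ≤ Subgroup.centralizer (K i) :=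
      iSup₂_le fun j hj y hy => Subgroup.mem_centralizer_iff.2 fun x hx =>
        comm i j hj.symm x hx y hy
    have h₂ : ⨆ j, K j ≤ Subgroup.centralizer {z} := iSup_le fun j y hy => by
      rw [Subgroup.mem_centralizer_singleton_iff]
      obtain rfl | hj := eq_or_ne j i
      · exact Subgroup.mem_centralizer_iff.1 (h₁ hz') y hy
      · exact comm j i hj y hy z hz
    rw [prod_eq] at h₂
    exact Subgroup.mem_center_iff.2 fun y =>
      Subgroup.mem_centralizer_singleton_iff.1 (h₂ (Subgroup.mem_top y))

theorem isCentralProduct_Upsilon : IsCentralProduct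
    ![(Upsilon₁ G).subgroupOf (commutator (Nu G)), (Upsilon₂ G).subgroupOf (commutator (Nu G)),
      (Upsilon₃ G).subgroupOf (commutator (Nu G))] := by
  refine .of_commute ?_ ?_ ?_
  · intro i
    fin_cases i
    · exact (inferInstance : ((Upsilon₁ G).subgroupOf (commutator (Nu G))).Normal)
    · exact (inferInstance : ((Upsilon₂ G).subgroupOf (commutator (Nu G))).Normal)
    · exact (inferInstance : ((Upsilon₃ G).subgroupOf (commutator (Nu G))).Normal)
  · have h : (Upsilon₁ G ⊔ Upsilon₂ G ⊔ Upsilon₃ G).subgroupOf (commutator (Nu G)) = ⊤ :=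
      Subgroup.subgroupOf_eq_top.2 commutator_le_sup
    rw [Subgroup.subgroupOf_sup (sup_le Upsilon₁_le_commutator Upsilon₂_le_commutator)
      Upsilon₃_le_commutator, Subgroup.subgroupOf_sup Upsilon₁_le_commutator
      Upsilon₂_le_commutator] at h
    rw [eq_top_iff, ← h]
    exact sup_le (sup_le (le_iSup_of_le 0 le_rfl) (le_iSup_of_le 1 le_rfl))
      (le_iSup_of_le 2 le_rfl)
  · have h₁₂ {x y : Nu G} (hx : x ∈ Upsilon₁ G) (hy : y ∈ Upsilon₂ G) : Commute x y :=
      commute_Upsilon₁_Theta hx (Upsilon₂_le hy).1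
    have h₁₃ {x y : Nu G} (hx : x ∈ Upsilon₁ G) (hy : y ∈ Upsilon₃ G) : Commute x y :=
      commute_Upsilon₁_Theta hx (Upsilon₃_le hy).1
    intro i j hij x hx y hy
    suffices Commute (x : Nu G) y from Subtype.ext this
    fin_cases i <;> fin_cases j <;> first | exact absurd rfl hij | skip
    · exact h₁₂ hx hy
    · exact h₁₃ hx hy
    · exact (h₁₂ hy hx).symm
    · exact commute_Upsilon₂_Upsilon₃ hx hy
    · exact (h₁₃ hy hx).symm
    · exact (commute_Upsilon₂_Upsilon₃ hy hx).symm

/-! ### The quotient of the derived subgroup by `μ(G)` -/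

theorem mu_eq : mu G = Upsilon₁ G ⊓ Theta G := by
  ext x
  constructor
  · rintro ⟨u, hu, rfl⟩
    exact ⟨u.2, congrArg Subtype.val (MonoidHom.mem_ker.1 hu)⟩
  · rintro ⟨hx, hx'⟩
    exact ⟨⟨x, hx⟩, Subtype.ext hx', rfl⟩

instance : (mu G).Normal := by rw [mu_eq]; infer_instance

theorem mu_le_commutator : mu G ≤ commutator (Nu G) := by
  rw [mu_eq]; exact inf_le_left.trans Upsilon₁_le_commutator

/-- The map between derived subgroups induced by a homomorphism. -/
def derivedMap {H K : Type*} [Group H] [Group K] (f : H →* K) : commutator H →* commutator K :=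
  (f.comp (commutator H).subtype).codRestrict (commutator K) fun x =>
    (Subgroup.map_commutator ⊤ ⊤ f).le.trans (Subgroup.commutator_mono le_top le_top)
      (Subgroup.mem_map_of_mem f x.2)

theorem coe_derivedMap {H K : Type*} [Group H] [Group K] (f : H →* K) (x : commutator H) :
    (derivedMap f x : K) = f x := rfl

theorem exists_rho_tensorToNu {a : G} (ha : a ∈ commutator G) :
    ∃ t, rho G (tensorToNu t) = a := by
  suffices h : commutator G ≤ ((rho G).comp tensorToNu).range from h ha
  rw [commutator_def]
  refine Subgroup.commutator_le.2 fun x _ y _ => ⟨tmul x⁻¹ y⁻¹, ?_⟩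
  simp [tensorToNu_tmul, cm, cj, commutatorElement_def, mul_assoc]

/-- The map `ν(G)' → G' × G' × G'` whose components are the two projections and `ρ`. -/
def derivedProd : commutator (Nu G) →* commutator G × commutator G × commutator G :=
  (derivedMap fstHom).prod ((derivedMap sndHom).prod (derivedMap (rho G)))

theorem ker_derivedProd :
    (derivedProd (G := G)).ker = (mu G).subgroupOf (commutator (Nu G)) := by
  ext x
  rw [MonoidHom.mem_ker, Subgroup.mem_subgroupOf, mu_eq, Upsilon₁_eq]
  simp [derivedProd, Prod.ext_iff, Subtype.ext_iff, coe_derivedMap, Theta, MonoidHom.mem_ker,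
    Subgroup.mem_inf, and_assoc]

/-- The three factors are the images of `Υ₂(G)`, `Υ₃(G)` and `Υ₁(G)`. -/
theorem derivedProd_surjective : Function.Surjective (derivedProd (G := G)) := by
  rintro ⟨⟨a, ha⟩, ⟨b, hb⟩, ⟨c, hc⟩⟩
  obtain ⟨r, rfl⟩ := exists_rho_tensorToNu ha
  obtain ⟨s, rfl⟩ := exists_rho_tensorToNu hb
  obtain ⟨t, rfl⟩ := exists_rho_tensorToNu hc
  refine ⟨⟨shear (ofG G) (rho_ofG G) r * shear (ofPhi G) (rho_ofPhi G) s * tensorToNu t,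
    mul_mem (mul_mem (Upsilon₂_le_commutator (shear_ofG_mem r))
      (Upsilon₃_le_commutator (shear_ofPhi_mem s)))
      (Upsilon₁_le_commutator (range_tensorToNu.le ⟨t, rfl⟩))⟩, ?_⟩
  simp [derivedProd, Prod.ext_iff, Subtype.ext_iff, coe_derivedMap]
  simp [shear_apply]

end NuGroup

theorem theoremA (G : Type*) [Group G] :
    -- (a)
    Nonempty (NuGroup.Upsilon₂ G ≃* NuGroup.TensorSquare G) ∧
    Nonempty (NuGroup.Upsilon₃ G ≃* NuGroup.TensorSquare G) ∧
    -- (b)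
    (NuGroup.Upsilon₁ G ≤ commutator (NuGroup.Nu G) ∧
      NuGroup.Upsilon₂ G ≤ commutator (NuGroup.Nu G) ∧
      NuGroup.Upsilon₃ G ≤ commutator (NuGroup.Nu G) ∧
      NuGroup.IsCentralProduct
        ![(NuGroup.Upsilon₁ G).subgroupOf (commutator (NuGroup.Nu G)),
          (NuGroup.Upsilon₂ G).subgroupOf (commutator (NuGroup.Nu G)),
          (NuGroup.Upsilon₃ G).subgroupOf (commutator (NuGroup.Nu G))]) ∧
    -- moreover
    (NuGroup.mu G ≤ commutator (NuGroup.Nu G) ∧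
      ∃ _ : ((NuGroup.mu G).subgroupOf (commutator (NuGroup.Nu G))).Normal,
        Nonempty
          ((commutator (NuGroup.Nu G) ⧸ (NuGroup.mu G).subgroupOf (commutator (NuGroup.Nu G))) ≃*
            commutator G × commutator G × commutator G)) :=
  ⟨⟨NuGroup.tensorEquivUpsilon₂.symm⟩, ⟨NuGroup.tensorEquivUpsilon₃.symm⟩,
    ⟨NuGroup.Upsilon₁_le_commutator, NuGroup.Upsilon₂_le_commutator,
      NuGroup.Upsilon₃_le_commutator, NuGroup.isCentralProduct_Upsilon⟩,
    NuGroup.mu_le_commutator, inferInstance,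
    ⟨(QuotientGroup.quotientMulEquivOfEq NuGroup.ker_derivedProd.symm).trans
      (QuotientGroup.quotientKerEquivOfSurjective _ NuGroup.derivedProd_surjective)⟩⟩
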